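/- **The game.** Let $n\ge 2$, $\varepsilon>0$, and $F_0\le F_{n+1}$ be real numbers. The Totalitarian Tug-of-War on the graph segment with running nodes $x_1,\dots,x_n$ and terminal nodes $x_0,x_{n+1}$ ($x_i$ adjacent to $x_{i\pm1}$) is played as follows. A token starts at a running node. At each turn Player I either plays a round of classical random Tug-of-War (a fair coin is tossed and the winner moves the token to a neighbor of his or her choice), or forces Player II to choose the neighbor to which the token moves, in exchange for a payment $\varepsilon$. The game ends at the first time $\tau$ at which the token reaches $x_0$ or $x_{n+1}$, and Player I then receives from Player II the payoff $F_\tau+k_\tau\varepsilon$, where $F_\tau\in\{F_0,F_{n+1}\}$ is the payoff of the terminal node reached and $k_\tau$ is the number of turns in which Player II was forced to choose. Pure strategies $S_I,S_{II}$ are functions from histories to actions. Let $V^{x}_{S_I,S_{II}}(I)$ and $V^{x}_{S_I,S_{II}}(II)$ be equal to the expected payoff $\mathbb E^{x}_{S_I,S_{II}}[F_\tau+k_\tau\varepsilon]$ if the game started at $x$ ends almost surely, and to $-\infty$ and $+\infty$ respectively otherwise. The game has value $u_i$ at $x_i$ if $$\sup_{S_I}\inf_{S_{II}}V^{x_i}_{S_I,S_{II}}(I)=\inf_{S_{II}}\sup_{S_I}V^{x_i}_{S_I,S_{II}}(II)=u_i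 ,$$ and a pair $(S_I,S_{II})$ realizes the value if, for every $1\le i\le n$, the game started at $x_i$ ends almost surely under this pair and $\mathbb E^{x_i}_{S_I,S_{II}}[F_\tau+k_\tau\varepsilon]=u_i$. **Theorem.** Let $Q=(F_{n+1}-F_0)/\varepsilon\ge 0$. The game has a value $(u_i)_{1\le i\le n}$, and the following cases are exhaustive. (a) If $Q>n+1$, then $$u_i=\frac{n+1-i}{n+1}F_0+\frac{i}{n+1}F_{n+1},\qquad 1\le i\le n.$$ The value is realized when the players always play classical random Tug-of-War, Player I moving towards $x_{n+1}$ and Player II towards $x_0$. (b) If $n-1<Q\le n+1$, then $u_i=F_0+i\varepsilon$ for $1\le i\le n$. The value is realized when Player I always forces Player II to choose, and Player II moves towards $x_0$. Moreover, if $Q=n+1$, then for each integer $j\in[0,n]$ the value is also realized by the following pair: at $x_i$ with $1\le i\le j$, Player I forces Player II to choose, who moves towards $x_0$; at $x_i$ with $j+1\le i\le n$, the players play classical random Tug-of-War, Player I moving towards $x_{n+1}$ and Player II towards $x_0$. (The case $j=n$ is the previous pair.) (c) If $2k-n-1<Q\le 2k-n+1$ for an integer $k\in[1,n-1]$, then $$u_i=\begin{cases}F_0+i\varepsilon,&1\le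 i\le k,\\ F_{n+1}+(n+1-i)\varepsilon,&k+1\le i\le n.\end{cases}$$ The value is realized when Player I always forces Player II to choose, and Player II moves towards $x_0$ at $x_i$ with $1\le i\le k$ and towards $x_{n+1}$ at $x_i$ with $k+1\le i\le n$. Moreover, if $Q=2k-n+1$, then for each integer $j\in[0,k]$ the value is also realized by the following pair: at $x_i$ with $1\le i\le j$, Player I forces Player II to choose, who moves towards $x_0$; at $x_i$ with $j+1\le i\le k$, the players play classical random Tug-of-War, Player I moving towards $x_{n+1}$ and Player II towards $x_0$; at $x_i$ with $k+1\le i\le n$, Player I forces Player II to choose, who moves towards $x_{n+1}$. (The case $j=k$ is the previous pair.) -/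

import Mathlib

open MeasureTheory

noncomputable section

/-- The data of a Totalitarian Tug-of-War on the graph segment with nodes `x_0, x_1, …, x_{n+1}`
(the node `x_i` is represented by the number `i`, and `x_i`, `x_{i+1}` are adjacent).
The running nodes are `x_1, …, x_n`, the terminal nodes are `x_0` and `x_{n+1}`. -/
structure SegmentGame where
  /-- number of running nodes -/
  n : ℕ
  /-- payment to Player I each time Player II is forced to choose the next position -/
  ε : ℝ
  /-- terminal payoff `F_0` at `x_0` -/
  F₀ : ℝ
  /-- terminal payoff `F_{n+1}` at `x_{n+1}` -/
  F₁ : ℝ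

/-- The two neighbors of a running node: `left` is the one towards `x_0`,
`right` is the one towards `x_{n+1}`. -/
inductive Direction
  | left
  | right

/-- The node adjacent to `x` in the given direction. -/
def Direction.step : Direction → ℕ → ℕ
  | .left, x => x - 1
  | .right, x => x + 1

/-- What Player I can do at a running node: play a round of classical random Tug-of-War, with the
intention to move in direction `d` if the toss is won, or force Player II to choose the next
position in exchange for a payment of `ε`. -/
inductive ActionI
  | play (d : Direction)
  | force

/-- What happened in one turn, as recorded in the history: who moved, in which direction,
and whether Player II moved after winning the toss or because Player I forced the choice. -/
inductive TurnRecord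
  | wonByI (d : Direction)
  | wonByII (d : Direction)
  | forcedII (d : Direction)

/-- The direction in which the token was moved. -/
def TurnRecord.dir : TurnRecord → Direction
  | .wonByI d => d
  | .wonByII d => d
  | .forcedII d => d

/-- Whether Player II was forced to choose in this turn. -/
def TurnRecord.isForced : TurnRecord → Bool
  | .forcedII _ => true
  | _ => false

/-- A history `(x^0, a^0, x^1, a^1, …, a^{k-1}, x^k)`: `past` is the list of the pairs `(x^i, a^i)`
for `i < k`, the most recent one first, and `current` is the present position `x^k`. -/
structure History where
  past : List (ℕ × TurnRecord)
  current : ℕ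

/-- The history after one more turn in which `a` happened. -/
def History.extend (h : History) (a : TurnRecord) : History :=
  ⟨(h.current, a) :: h.past, a.dir.step h.current⟩

/-- The number of turns so far in which Player II was forced to choose. -/
def History.numForced (h : History) : ℕ :=
  h.past.countP fun p => p.2.isForced

/-- Pure strategies of Player I: an action for every history. -/
abbrev StrategyI := History → ActionI

/-- Pure strategies of Player II: for every history, the direction chosen whenever
it is Player II who decides. -/
abbrev StrategyII := History → Direction

/-- The strategy of Player I whose action depends only on the current node. -/
def StrategyI.ofNode (f : ℕ → ActionI) : StrategyI := fun h => f h.current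

/-- The strategy of Player II whose action depends only on the current node. -/
def StrategyII.ofNode (f : ℕ → Direction) : StrategyII := fun h => f h.current

/-- One turn of the game; `coin = true` means that Player I wins the toss
(the toss is ignored if Player I forces Player II to choose). -/
def turn (S : StrategyI) (T : StrategyII) (coin : Bool) (h : History) : History :=
  match S h with
  | .force => h.extend (.forcedII (T h))
  | .play d => if coin then h.extend (.wonByI d) else h.extend (.wonByII (T h))

/-- A fair coin. -/
def fairCoin : Measure Bool := (PMF.uniformOfFintype Bool).toMeasure

/-- The law of a sequence of independent fair coin tosses, one for each turn. -/
def coinTosses : Measure (ℕ → Bool) := Measure.infinitePi fun _ => fairCoin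

/-- The expectation, in `[-∞, ∞]`, of a real random variable
(every random variable to which it is applied below is bounded from below). -/
def extendedExpectation {Ω : Type*} [MeasurableSpace Ω] (P : Measure Ω) (X : Ω → ℝ) : EReal :=
  ((∫⁻ ω, ENNReal.ofReal (X ω) ∂P : ENNReal) : EReal) -
    ((∫⁻ ω, ENNReal.ofReal (-X ω) ∂P : ENNReal) : EReal)

namespace SegmentGame

variable (G : SegmentGame)

/-- The terminal nodes are `x_0` and `x_{n+1}`. -/
def terminal : Set ℕ := {0, G.n + 1}

/-- The terminal payoff. -/
def terminalPayoff (x : ℕ) : ℝ := if x = 0 then G.F₀ else G.F₁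

open Classical in
/-- The history after at most `t` turns, for the game started at `x_i`, with tosses `ω`;
nothing happens any more once a terminal node is reached. -/
def historyAt (S : StrategyI) (T : StrategyII) (i : ℕ) (ω : ℕ → Bool) : ℕ → History
  | 0 => ⟨[], i⟩
  | t + 1 =>
    if (historyAt S T i ω t).current ∈ G.terminal then historyAt S T i ω t
    else turn S T (ω t) (historyAt S T i ω t)

/-- The set of times at which the token is at a terminal node. -/
def terminalTimes (S : StrategyI) (T : StrategyII) (i : ℕ) (ω : ℕ → Bool) : Set ℕ :=
  {t | (G.historyAt S T i ω t).current ∈ G.terminal}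

/-- The game ends almost surely. -/
def EndsAlmostSurely (S : StrategyI) (T : StrategyII) (i : ℕ) : Prop :=
  ∀ᵐ ω ∂coinTosses, (G.terminalTimes S T i ω).Nonempty

/-- The final history, at the first time `τ` at which a terminal node is reached
(only meaningful for `ω` such that the game ends). -/
def finalHistory (S : StrategyI) (T : StrategyII) (i : ℕ) (ω : ℕ → Bool) : History :=
  G.historyAt S T i ω (sInf (G.terminalTimes S T i ω))

/-- The payoff `F_τ + k_τ ε` that Player I receives from Player II at the end of the game. -/
def payoff (S : StrategyI) (T : StrategyII) (i : ℕ) (ω : ℕ → Bool) : ℝ :=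
  G.terminalPayoff (G.finalHistory S T i ω).current +
    (G.finalHistory S T i ω).numForced * G.ε

/-- The expected payoff of the game started at `x_i`. -/
def expectedPayoff (S : StrategyI) (T : StrategyII) (i : ℕ) : EReal :=
  extendedExpectation coinTosses (G.payoff S T i)

open Classical in
/-- The expected payoff for Player I, who gets `-∞` if the game does not end almost surely. -/
def payoffI (S : StrategyI) (T : StrategyII) (i : ℕ) : EReal :=
  if G.EndsAlmostSurely S T i then G.expectedPayoff S T i else ⊥

open Classical in
/-- The expected payment for Player II, who pays `+∞` if the game does not end almost surely. -/
def payoffII (S : StrategyI) (T : StrategyII) (i : ℕ) : EReal :=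
  if G.EndsAlmostSurely S T i then G.expectedPayoff S T i else ⊤

/-- The value of the game for Player I, started at `x_i`. -/
def valueI (i : ℕ) : EReal := ⨆ S : StrategyI, ⨅ T : StrategyII, G.payoffI S T i

/-- The value of the game for Player II, started at `x_i`. -/
def valueII (i : ℕ) : EReal := ⨅ T : StrategyII, ⨆ S : StrategyI, G.payoffII S T i

/-- The game has a value, given by `u i` when it starts at the running node `x_i`:
the values for both players agree and are equal to `u i`. -/
def HasValue (u : ℕ → ℝ) : Prop :=
  ∀ i, 1 ≤ i → i ≤ G.n → G.valueI i = (u i : EReal) ∧ G.valueII i = (u i : EReal)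

/-- The pair of strategies `S`, `T` yields the payoffs `u`: from every running node `x_i`, the game
ends almost surely and its expected payoff is `u i`. If `u` is the value of the game, the pair
realizes the value. -/
def Realizes (S : StrategyI) (T : StrategyII) (u : ℕ → ℝ) : Prop :=
  ∀ i, 1 ≤ i → i ≤ G.n → G.EndsAlmostSurely S T i ∧ G.expectedPayoff S T i = (u i : EReal)

/-- The quantity `Q = (F_{n+1} - F_0) / ε`. -/
def Q : ℝ := (G.F₁ - G.F₀) / G.ε

end SegmentGame

end

noncomputable section

open ProbabilityTheory Filter Topology

/-! Give a position `x` the price `u x` and follow the potential `u x + kε`, where `k` counts the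
forced turns so far. The theorem amounts to finding `u` with the right terminal values for which
each player can stop this potential from drifting the wrong way.

For Player II, suppose a step in some direction lowers `u` by at least `ε`, and its average with
either neighbor is at most `u x`. Moving in that direction makes the potential a supermartingale
whatever Player I does, and Fatou's lemma bounds the expected payoff by `u i`. Aiming at one end on
each side of a dividing edge also ends the game almost surely.

For Player I, if `u` is linear and nondecreasing, pulling right gives a submartingale. If instead
`u` varies by at most `ε` along each edge, a forced turn never lowers the potential. Forcing forever
might never end, so Player I forces only `K` times, with `Kε > u i - F₀`, and then pulls right:
either the game ends during the forced phase with payoff at least `u i`, or the collected payments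
already suffice.

The linear profile has slope at least `ε` when `Q > n + 1`. Otherwise the profile rises with slope
`ε` up to `k`, then falls with slope `-ε` from `k + 1`; its jump across this edge is `(Q - (2k -
n))ε`, which lies in `(-ε, ε]` exactly in case (c), and in case (b) for `k = n`. When the jump
equals `ε`, the rising part extends to `k + 1`, so forcing and playing are equally good on it: hence
the additional optimal pairs. -/

instance : IsProbabilityMeasure fairCoin := PMF.toMeasure.isProbabilityMeasure _

instance : IsProbabilityMeasure coinTosses :=
  inferInstanceAs (IsProbabilityMeasure (Measure.infinitePi fun _ : ℕ => fairCoin))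

/-! ### Functions of finitely many tosses -/

lemma DependsOn.exists_eq_comp_restrict_range {β : Type*} [Nonempty β] {t : ℕ}
    {X : (ℕ → Bool) → β} (hX : DependsOn X (Finset.range t : Set ℕ)) :
    ∃ g : (Finset.range t → Bool) → β, X = g ∘ fun ω i => ω i := by
  obtain ⟨g, hg⟩ := dependsOn_iff_exists_comp.1 hX
  exact ⟨fun v => g fun i => v ⟨i.1, i.2⟩, hg⟩

lemma DependsOn.measurable_of_range {t : ℕ} {X : (ℕ → Bool) → ℝ}
    (hX : DependsOn X (Finset.range t : Set ℕ)) : Measurable X := by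
  obtain ⟨g, rfl⟩ := hX.exists_eq_comp_restrict_range
  exact (measurable_of_finite g).comp (measurable_pi_lambda _ fun i => measurable_pi_apply _)

/-- Finitely many tosses have finitely many outcomes, so the function takes finitely many values. -/
lemma DependsOn.integrable_of_range {t : ℕ} {X : (ℕ → Bool) → ℝ}
    (hX : DependsOn X (Finset.range t : Set ℕ)) : Integrable X coinTosses := by
  have hm := hX.measurable_of_range
  obtain ⟨g, rfl⟩ := hX.exists_eq_comp_restrict_range
  refine Integrable.of_bound hm.aestronglyMeasurable (∑ v, ‖g v‖) (Eventually.of_forall fun ω => ?_)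
  exact Finset.single_le_sum (f := fun v => ‖g v‖) (fun _ _ => norm_nonneg _) (Finset.mem_univ _)

lemma indepFun_eval_of_dependsOn {t : ℕ} {X : (ℕ → Bool) → ℝ}
    (hX : DependsOn X (Finset.range t : Set ℕ)) (φ : Bool → ℝ) :
    IndepFun X (fun ω => φ (ω t)) coinTosses := by
  obtain ⟨g, rfl⟩ := hX.exists_eq_comp_restrict_range
  have hI : iIndepFun (fun (i : ℕ) (ω : ℕ → Bool) => ω i) coinTosses :=
    iIndepFun_infinitePi (P := fun _ : ℕ => fairCoin) (X := fun _ b => b) fun _ => measurable_id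
  have h := hI.indepFun_finset (Finset.range t) {t} (by simp) fun i => measurable_pi_apply i
  exact h.comp (φ := g) (ψ := fun v => φ (v ⟨t, by simp⟩)) (measurable_of_finite g)
    (measurable_of_finite _)

lemma integral_toss (t : ℕ) (φ : Bool → ℝ) :
    ∫ ω, φ (ω t) ∂coinTosses = (φ true + φ false) / 2 := by
  have hp : MeasurePreserving (Function.eval t) coinTosses fairCoin :=
    measurePreserving_eval_infinitePi (fun _ : ℕ => fairCoin) t
  have h := hp.map_eq ▸ (integral_map (μ := coinTosses) hp.measurable.aemeasurable
    (f := φ) (measurable_of_finite φ).aestronglyMeasurable)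
  rw [show (∫ ω, φ (ω t) ∂coinTosses) = ∫ b, φ b ∂fairCoin from h.symm, fairCoin,
    PMF.integral_eq_sum]
  simp [PMF.uniformOfFintype_apply]
  ring

/-- Toss `t` is independent of everything determined by the earlier tosses, so each branch receives
weight one half. -/
lemma integral_ite_toss {t : ℕ} {X Y : (ℕ → Bool) → ℝ}
    (hX : DependsOn X (Finset.range t : Set ℕ)) (hY : DependsOn Y (Finset.range t : Set ℕ)) :
    ∫ ω, (if ω t then X ω else Y ω) ∂coinTosses = ∫ ω, (X ω + Y ω) / 2 ∂coinTosses := by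
  have key : ∀ {Z : (ℕ → Bool) → ℝ}, DependsOn Z (Finset.range t : Set ℕ) → ∀ φ : Bool → ℝ,
      Integrable (fun ω => Z ω * φ (ω t)) coinTosses ∧
      ∫ ω, Z ω * φ (ω t) ∂coinTosses = (∫ ω, Z ω ∂coinTosses) * ((φ true + φ false) / 2) := by
    intro Z hZ φ
    have hφ : Integrable (fun ω : ℕ → Bool => φ (ω t)) coinTosses :=
      DependsOn.integrable_of_range (t := t + 1) fun x y h => by
        rw [h t (by simp)]
    have hI := indepFun_eval_of_dependsOn hZ φ
    refine ⟨hI.integrable_mul hZ.integrable_of_range hφ, ?_⟩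
    rw [hI.integral_fun_mul_eq_mul_integral hZ.integrable_of_range.aestronglyMeasurable
      hφ.aestronglyMeasurable, integral_toss]
  obtain ⟨i1, e1⟩ := key hX fun b => if b then 1 else 0
  obtain ⟨i2, e2⟩ := key hY fun b => if b then 0 else 1
  have : (fun ω : ℕ → Bool => if ω t then X ω else Y ω) = fun ω =>
      X ω * (if ω t then 1 else 0) + Y ω * (if ω t then 0 else 1) := by
    ext ω; cases ω t <;> simp
  rw [this, integral_add i1 i2, e1, e2, integral_div,
    integral_add hX.integrable_of_range hY.integrable_of_range]
  simp
  ring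

/-! ### Extended expectations -/

/-- No measurability or integrability is needed, so a pathwise bound on the payoff passes directly
to its expectation. -/
lemma extendedExpectation_mono {Ω : Type*} [MeasurableSpace Ω] {P : Measure Ω} {X Y : Ω → ℝ}
    (h : ∀ᵐ ω ∂P, X ω ≤ Y ω) : extendedExpectation P X ≤ extendedExpectation P Y := by
  refine EReal.sub_le_sub (EReal.coe_ennreal_le_coe_ennreal_iff.2 (lintegral_mono_ae ?_))
    (EReal.coe_ennreal_le_coe_ennreal_iff.2 (lintegral_mono_ae ?_))
  · filter_upwards [h] with ω hω using ENNReal.ofReal_le_ofReal hω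
  · filter_upwards [h] with ω hω using ENNReal.ofReal_le_ofReal (neg_le_neg hω)

lemma extendedExpectation_of_integrable {Ω : Type*} [MeasurableSpace Ω] {P : Measure Ω}
    {X : Ω → ℝ} (h : Integrable X P) : extendedExpectation P X = ((∫ ω, X ω ∂P : ℝ) : EReal) := by
  have h1 : ∫⁻ ω, ENNReal.ofReal (X ω) ∂P ≠ ⊤ := h.lintegral_lt_top.ne
  have h2 : ∫⁻ ω, ENNReal.ofReal (-X ω) ∂P ≠ ⊤ := h.neg.lintegral_lt_top.ne
  rw [integral_eq_lintegral_pos_part_sub_lintegral_neg_part h, extendedExpectation, EReal.coe_sub,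
    EReal.coe_ennreal_toReal h1, EReal.coe_ennreal_toReal h2]

lemma extendedExpectation_const {Ω : Type*} [MeasurableSpace Ω] (P : Measure Ω)
    [IsProbabilityMeasure P] (c : ℝ) : extendedExpectation P (fun _ => c) = c := by
  rw [extendedExpectation_of_integrable (integrable_const c)]
  simp

/-! ### Single turns -/

lemma turn_of_force {S : StrategyI} {h : History} (hS : S h = .force) (T : StrategyII)
    (b : Bool) : turn S T b h = h.extend (.forcedII (T h)) := by
  simp [turn, hS]

lemma turn_true_of_play {S : StrategyI} {h : History} {d : Direction} (hS : S h = .play d)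
    (T : StrategyII) : turn S T true h = h.extend (.wonByI d) := by
  simp [turn, hS]

lemma turn_false_of_play {S : StrategyI} {h : History} {d : Direction} (hS : S h = .play d)
    (T : StrategyII) : turn S T false h = h.extend (.wonByII (T h)) := by
  simp [turn, hS]

namespace History

variable (h : History) (d : Direction)

@[simp] lemma current_extend (a : TurnRecord) : (h.extend a).current = a.dir.step h.current := rfl

@[simp] lemma numForced_extend_forcedII :
    (h.extend (.forcedII d)).numForced = h.numForced + 1 := by
  simp [History.extend, History.numForced, TurnRecord.isForced]

@[simp] lemma numForced_extend_wonByI : (h.extend (.wonByI d)).numForced = h.numForced := by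
  simp [History.extend, History.numForced, TurnRecord.isForced]

@[simp] lemma numForced_extend_wonByII : (h.extend (.wonByII d)).numForced = h.numForced := by
  simp [History.extend, History.numForced, TurnRecord.isForced]

end History

@[simp] lemma TurnRecord.dir_wonByI (d : Direction) : (TurnRecord.wonByI d).dir = d := rfl
@[simp] lemma TurnRecord.dir_wonByII (d : Direction) : (TurnRecord.wonByII d).dir = d := rfl
@[simp] lemma TurnRecord.dir_forcedII (d : Direction) : (TurnRecord.forcedII d).dir = d := rfl
@[simp] lemma Direction.step_left (x : ℕ) : Direction.left.step x = x - 1 := rfl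
@[simp] lemma Direction.step_right (x : ℕ) : Direction.right.step x = x + 1 := rfl

lemma Direction.step_le (d : Direction) (x : ℕ) : d.step x ≤ x + 1 := by
  cases d <;> simp only [step_left, step_right] <;> omega

namespace SegmentGame

variable (G : SegmentGame) (S : StrategyI) (T : StrategyII) (i : ℕ)

lemma mem_terminal {x : ℕ} : x ∈ G.terminal ↔ x = 0 ∨ x = G.n + 1 := by
  simp [terminal]

lemma historyAt_succ_of_mem {ω : ℕ → Bool} {t : ℕ}
    (h : (G.historyAt S T i ω t).current ∈ G.terminal) :
    G.historyAt S T i ω (t + 1) = G.historyAt S T i ω t := by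
  rw [historyAt, if_pos h]

lemma historyAt_succ_of_notMem {ω : ℕ → Bool} {t : ℕ}
    (h : (G.historyAt S T i ω t).current ∉ G.terminal) :
    G.historyAt S T i ω (t + 1) = turn S T (ω t) (G.historyAt S T i ω t) := by
  rw [historyAt, if_neg h]

/-- An invariant of running histories holds for all histories of the game. -/
lemma historyAt_induction {p : History → Prop} (h0 : p ⟨[], i⟩)
    (hp : ∀ h b, h.current ∉ G.terminal → p h → p (turn S T b h)) (ω : ℕ → Bool) (t : ℕ) :
    p (G.historyAt S T i ω t) := by
  induction t with
  | zero => exact h0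
  | succ t ih =>
    by_cases h : (G.historyAt S T i ω t).current ∈ G.terminal
    · rwa [historyAt_succ_of_mem _ _ _ _ h]
    · rw [historyAt_succ_of_notMem _ _ _ _ h]
      exact hp _ _ h ih

lemma turn_current_le {h : History} {b : Bool} {m : ℕ} (hm : h.current + 1 ≤ m) :
    (turn S T b h).current ≤ m := by
  rcases hS : S h with d | _
  · cases b
    · rw [turn_false_of_play hS]
      exact (Direction.step_le _ _).trans hm
    · rw [turn_true_of_play hS]
      exact (Direction.step_le _ _).trans hm
  · rw [turn_of_force hS]
    exact (Direction.step_le _ _).trans hm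

variable {i} in
lemma historyAt_current_le (hi : i ≤ G.n) (ω : ℕ → Bool) (t : ℕ) :
    (G.historyAt S T i ω t).current ≤ G.n + 1 := by
  refine G.historyAt_induction S T i (p := fun h => h.current ≤ G.n + 1) (by simpa using by omega)
    (fun h b ht hh => turn_current_le S T ?_) ω t
  rw [mem_terminal] at ht
  omega

variable {i} in
lemma historyAt_running (hi : i ≤ G.n) {ω : ℕ → Bool} {t : ℕ}
    (h : (G.historyAt S T i ω t).current ∉ G.terminal) :
    1 ≤ (G.historyAt S T i ω t).current ∧ (G.historyAt S T i ω t).current ≤ G.n := by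
  have := G.historyAt_current_le S T hi ω t
  rw [mem_terminal] at h
  omega

/-- Replaces measurability: `History` carries no σ-algebra, yet every real function of the history
after `t` turns is integrable, being a function of finitely many tosses. -/
lemma historyAt_dependsOn (t : ℕ) :
    DependsOn (fun ω => G.historyAt S T i ω t) (Finset.range t : Set ℕ) := by
  induction t with
  | zero => intro x y _; rfl
  | succ t ih =>
    intro x y h
    have h1 : G.historyAt S T i x t = G.historyAt S T i y t :=
      ih fun s hs => h s (by simp at hs ⊢; omega)
    have h2 : x t = y t := h t (by simp)
    simp only [historyAt]
    rw [h1, h2]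

lemma comp_historyAt_dependsOn (F : History → ℝ) (t : ℕ) :
    DependsOn (fun ω => F (G.historyAt S T i ω t)) (Finset.range t : Set ℕ) :=
  fun _ _ h => congrArg F (G.historyAt_dependsOn S T i t h)

lemma integrable_historyAt (F : History → ℝ) (t : ℕ) :
    Integrable (fun ω => F (G.historyAt S T i ω t)) coinTosses :=
  (G.comp_historyAt_dependsOn S T i F t).integrable_of_range

open Classical in
/-- The mean of `F` after one more turn; terminal histories do not change any more. -/
def turnMean (F : History → ℝ) (h : History) : ℝ :=
  if h.current ∈ G.terminal then F h else (F (turn S T true h) + F (turn S T false h)) / 2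

lemma integral_historyAt_succ (F : History → ℝ) (t : ℕ) :
    ∫ ω, F (G.historyAt S T i ω (t + 1)) ∂coinTosses =
      ∫ ω, G.turnMean S T F (G.historyAt S T i ω t) ∂coinTosses := by
  classical
  -- The next history for a fixed outcome of the toss, with terminal histories frozen.
  let N (b : Bool) (h : History) : History := if h.current ∈ G.terminal then h else turn S T b h
  have h := integral_ite_toss (G.comp_historyAt_dependsOn S T i (fun h => F (N true h)) t)
    (G.comp_historyAt_dependsOn S T i (fun h => F (N false h)) t)
  convert h using 2
  · ext ω
    rw [historyAt]
    cases ω t <;> simp only [N] <;> split_ifs <;> simp_all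
  · ext ω
    simp only [turnMean, N]
    split_ifs
    · ring
    · rfl

/-- `F` is a supermartingale along the running histories. -/
lemma integral_historyAt_le {i : ℕ} (hi : i ≤ G.n) {F : History → ℝ}
    (hF : ∀ h : History, 1 ≤ h.current → h.current ≤ G.n →
      (F (turn S T true h) + F (turn S T false h)) / 2 ≤ F h) (t : ℕ) :
    ∫ ω, F (G.historyAt S T i ω t) ∂coinTosses ≤ F ⟨[], i⟩ := by
  induction t with
  | zero => simp [historyAt]
  | succ t ih =>
    rw [integral_historyAt_succ]
    refine le_trans (integral_mono (G.integrable_historyAt S T i _ t)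
      (G.integrable_historyAt S T i F t) fun ω => ?_) ih
    by_cases h : (G.historyAt S T i ω t).current ∈ G.terminal
    · simp [turnMean, h]
    · obtain ⟨h1, h2⟩ := G.historyAt_running S T hi h
      simpa [turnMean, h] using hF _ h1 h2

lemma le_integral_historyAt {i : ℕ} (hi : i ≤ G.n) {F : History → ℝ}
    (hF : ∀ h : History, 1 ≤ h.current → h.current ≤ G.n →
      F h ≤ (F (turn S T true h) + F (turn S T false h)) / 2) (t : ℕ) :
    F ⟨[], i⟩ ≤ ∫ ω, F (G.historyAt S T i ω t) ∂coinTosses := by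
  have h := G.integral_historyAt_le S T hi (F := fun h => -F h)
    (fun h h1 h2 => by linarith [hF h h1 h2]) t
  rw [integral_neg] at h
  linarith

/-! ### The end of the game -/

variable {G S T i} in
lemma historyAt_eq_of_le {ω : ℕ → Bool} {s t : ℕ}
    (h : (G.historyAt S T i ω s).current ∈ G.terminal) (hst : s ≤ t) :
    G.historyAt S T i ω t = G.historyAt S T i ω s := by
  induction t, hst using Nat.le_induction with
  | base => rfl
  | succ t _ ih => rw [historyAt_succ_of_mem _ _ _ _ (ih ▸ h), ih]

variable {G S T i} in
lemma finalHistory_mem {ω : ℕ → Bool} (h : (G.terminalTimes S T i ω).Nonempty) :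
    (G.finalHistory S T i ω).current ∈ G.terminal := Nat.sInf_mem h

variable {G S T i} in
lemma eventually_historyAt_eq {ω : ℕ → Bool} (h : (G.terminalTimes S T i ω).Nonempty) :
    ∀ᶠ t in atTop, G.historyAt S T i ω t = G.finalHistory S T i ω :=
  eventually_atTop.2 ⟨_, fun _ ht => historyAt_eq_of_le (finalHistory_mem h) ht⟩

/-- The game ends almost surely if from every running history one of the two outcomes of the next
toss decreases a bounded rank. -/
theorem endsAlmostSurely_of_rank {i : ℕ} (hi : i ≤ G.n) (D : History → ℕ) (N : ℕ)
    (hN : ∀ h, D h ≤ N)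
    (hD : ∀ h : History, 1 ≤ h.current → h.current ≤ G.n → ∃ b, D (turn S T b h) < D h) :
    G.EndsAlmostSurely S T i := by
  classical
  -- A Lyapunov function with values in `[-2 ^ N, -1]`. The favorable outcome at least doubles its
  -- absolute value and the other leaves it at most `-1`, so each running turn lowers its mean by at
  -- least `1 / 2`.
  let V : History → ℝ := fun h => -2 ^ (N - D h)
  let R : History → ℝ := fun h => if h.current ∈ G.terminal then 0 else 1
  have hV : ∀ h, V h ≤ -1 := fun h => neg_le_neg (one_le_pow₀ one_le_two)
  have hV' : ∀ h, -2 ^ N ≤ V h := fun h =>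
    neg_le_neg (pow_le_pow_right₀ one_le_two (Nat.sub_le _ _))
  have hstep : ∀ h : History, 1 ≤ h.current → h.current ≤ G.n →
      (V (turn S T true h) + V (turn S T false h)) / 2 ≤ V h - 1 / 2 := by
    intro h h1 h2
    have hlt : ∀ b, D (turn S T b h) < D h → V (turn S T b h) ≤ 2 * V h := by
      intro b hb
      have : (2 : ℝ) ^ (N - D h + 1) ≤ 2 ^ (N - D (turn S T b h)) :=
        pow_le_pow_right₀ one_le_two (by have := hN h; omega)
      rw [pow_succ] at this
      simp only [V]
      linarith
    obtain ⟨b, hb⟩ := hD h h1 h2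
    have := hlt b hb
    cases b
    · linarith [hV (turn S T true h)]
    · linarith [hV (turn S T false h)]
  -- The running probability is nonincreasing in time, so `t` times its latest value bounds the sum
  -- of the earlier ones.
  have hsum : ∀ t : ℕ, ∫ ω, V (G.historyAt S T i ω t) ∂coinTosses ≤
      V ⟨[], i⟩ - (t : ℝ) / 2 * ∫ ω, R (G.historyAt S T i ω t) ∂coinTosses := by
    intro t
    induction t with
    | zero => simp [historyAt]
    | succ t ih =>
      have hR : ∫ ω, R (G.historyAt S T i ω (t + 1)) ∂coinTosses ≤
          ∫ ω, R (G.historyAt S T i ω t) ∂coinTosses := by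
        refine integral_mono (G.integrable_historyAt S T i R _) (G.integrable_historyAt S T i R _)
          fun ω => ?_
        by_cases h : (G.historyAt S T i ω t).current ∈ G.terminal
        · simp only [historyAt_succ_of_mem _ _ _ _ h]; exact le_rfl
        · simp only [R, if_neg h]
          split_ifs <;> norm_num
      have h1 : ∫ ω, V (G.historyAt S T i ω (t + 1)) ∂coinTosses ≤
          ∫ ω, (V (G.historyAt S T i ω t) - 1 / 2 * R (G.historyAt S T i ω t)) ∂coinTosses := by
        rw [integral_historyAt_succ]
        refine integral_mono (G.integrable_historyAt S T i _ t)
          (G.integrable_historyAt S T i (fun h => V h - 1 / 2 * R h) t) fun ω => ?_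
        by_cases h : (G.historyAt S T i ω t).current ∈ G.terminal
        · simp [turnMean, h, R]
        · obtain ⟨h1, h2⟩ := G.historyAt_running S T hi h
          simpa [turnMean, h, R] using hstep _ h1 h2
      rw [integral_sub (G.integrable_historyAt S T i V t)
        ((G.integrable_historyAt S T i R t).const_mul _), integral_const_mul] at h1
      have := mul_le_mul_of_nonneg_left hR (a := ((t : ℝ) + 1) / 2) (by positivity)
      push_cast
      linarith
  have hbound : ∀ t : ℕ, (t : ℝ) * ∫ ω, R (G.historyAt S T i ω t) ∂coinTosses ≤ 2 * 2 ^ N := by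
    intro t
    have h1 : -2 ^ N ≤ ∫ ω, V (G.historyAt S T i ω t) ∂coinTosses := by
      have := integral_mono (integrable_const (μ := coinTosses) (-2 ^ N : ℝ))
        (G.integrable_historyAt S T i V t) fun ω => hV' _
      simpa using this
    linarith [hsum t, hV ⟨[], i⟩]
  let E : Set (ℕ → Bool) := {ω | ¬ (G.terminalTimes S T i ω).Nonempty}
  have hE : ∀ t, coinTosses.real E ≤ ∫ ω, R (G.historyAt S T i ω t) ∂coinTosses := by
    intro t
    let A : Set (ℕ → Bool) := {ω | (G.historyAt S T i ω t).current ∉ G.terminal}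
    have hRA : (fun ω => R (G.historyAt S T i ω t)) = A.indicator 1 := by
      ext ω
      simp only [R, A, Set.indicator, Set.mem_ofPred_eq]
      split_ifs <;> simp_all
    have hA : MeasurableSet A := by
      have := (G.comp_historyAt_dependsOn S T i R t).measurable_of_range (measurableSet_singleton 1)
      convert this using 1
      ext ω
      simp [R, A]
    rw [hRA, integral_indicator_one hA]
    exact measureReal_mono fun ω hω h => hω ⟨t, h⟩
  have hzero : coinTosses.real E = 0 := by
    by_contra h
    have hpos : 0 < coinTosses.real E := lt_of_le_of_ne measureReal_nonneg (Ne.symm h)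
    obtain ⟨t, ht⟩ := exists_nat_gt (2 * 2 ^ N / coinTosses.real E)
    rw [div_lt_iff₀ hpos] at ht
    have := mul_le_mul_of_nonneg_left (hE t) (Nat.cast_nonneg (α := ℝ) t)
    linarith [hbound t]
  rw [EndsAlmostSurely, ae_iff]
  exact (measureReal_eq_zero_iff).1 hzero

/-! ### Martingale bounds for the expected payoff -/

/-- The payoff of a game with history `h` if a token at `x` is worth `u x`. -/
def potential (u : ℕ → ℝ) (h : History) : ℝ := u h.current + h.numForced * G.ε

variable {G S T i}

lemma potential_finalHistory {u : ℕ → ℝ} (h0 : u 0 = G.F₀) (h1 : u (G.n + 1) = G.F₁)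
    {ω : ℕ → Bool} (h : (G.terminalTimes S T i ω).Nonempty) :
    G.potential u (G.finalHistory S T i ω) = G.payoff S T i ω := by
  rcases G.mem_terminal.1 (finalHistory_mem h) with hx | hx <;>
    simp [potential, payoff, terminalPayoff, hx, h0, h1]

lemma tendsto_potential {u : ℕ → ℝ} (h0 : u 0 = G.F₀) (h1 : u (G.n + 1) = G.F₁)
    (he : G.EndsAlmostSurely S T i) :
    ∀ᵐ ω ∂coinTosses, Tendsto (fun t => G.potential u (G.historyAt S T i ω t)) atTop
      (𝓝 (G.payoff S T i ω)) := by
  filter_upwards [he] with ω hω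
  refine tendsto_const_nhds.congr' ?_
  filter_upwards [eventually_historyAt_eq hω] with t ht
  rw [ht, potential_finalHistory h0 h1 hω]

/-- If the potential is a supermartingale, it bounds the expected payoff from above. -/
theorem expectedPayoff_le {u : ℕ → ℝ} (hε : 0 < G.ε) (h0 : u 0 = G.F₀) (h1 : u (G.n + 1) = G.F₁)
    (hi : i ≤ G.n) (he : G.EndsAlmostSurely S T i)
    (hF : ∀ h : History, 1 ≤ h.current → h.current ≤ G.n →
      (G.potential u (turn S T true h) + G.potential u (turn S T false h)) / 2 ≤
        G.potential u h) :
    G.expectedPayoff S T i ≤ (u i : EReal) := by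
  have hlim := tendsto_potential h0 h1 he
  set f : ℕ → (ℕ → Bool) → ℝ := fun t ω => G.potential u (G.historyAt S T i ω t) with hf
  -- Forced turns only add to the potential, so the shift by `B` makes it nonnegative.
  set B : ℝ := ∑ x ∈ Finset.range (G.n + 2), |u x| with hB
  have hfi : ∀ t, Integrable (f t) coinTosses := fun t => G.integrable_historyAt S T i _ t
  have hfB : ∀ t ω, 0 ≤ f t ω + B := by
    intro t ω
    have hx := G.historyAt_current_le S T hi ω t
    have := Finset.single_le_sum (f := fun x => |u x|) (fun _ _ => abs_nonneg _)
      (Finset.mem_range.2 (Nat.lt_succ_of_le hx))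
    have h2 := neg_abs_le (u (G.historyAt S T i ω t).current)
    have h3 : 0 ≤ ((G.historyAt S T i ω t).numForced : ℝ) * G.ε := by positivity
    simp only [hf, potential]
    linarith
  have hint : ∀ t, ∫ ω, f t ω + B ∂coinTosses ≤ u i + B := by
    intro t
    rw [integral_add (hfi t) (integrable_const B)]
    have := G.integral_historyAt_le S T hi hF t
    simp only [potential] at this
    simpa [History.numForced, hf, potential] using this
  have hm : AEMeasurable (G.payoff S T i) coinTosses :=
    aemeasurable_of_tendsto_metrizable_ae atTop (fun t => (hfi t).aemeasurable) hlim
  have hnn : 0 ≤ᵐ[coinTosses] fun ω => G.payoff S T i ω + B := by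
    filter_upwards [hlim] with ω hω
    exact ge_of_tendsto' (hω.add_const B) fun t => hfB t ω
  -- The number of forced turns need not be bounded, so there is no dominating function; Fatou's
  -- lemma still gives the upper bound, and integrability of the payoff with it.
  have hfatou : ∫⁻ ω, ENNReal.ofReal (G.payoff S T i ω + B) ∂coinTosses ≤
      ENNReal.ofReal (u i + B) := by
    calc ∫⁻ ω, ENNReal.ofReal (G.payoff S T i ω + B) ∂coinTosses
        = ∫⁻ ω, liminf (fun t => ENNReal.ofReal (f t ω + B)) atTop ∂coinTosses := by
          refine lintegral_congr_ae ?_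
          filter_upwards [hlim] with ω hω
          exact ((ENNReal.tendsto_ofReal (hω.add_const B)).liminf_eq).symm
      _ ≤ liminf (fun t => ∫⁻ ω, ENNReal.ofReal (f t ω + B) ∂coinTosses) atTop :=
          lintegral_liminf_le' fun t => ((hfi t).aemeasurable.add_const B).ennreal_ofReal
      _ ≤ ENNReal.ofReal (u i + B) := by
          refine (liminf_le_liminf (v := fun _ => ENNReal.ofReal (u i + B))
            (Eventually.of_forall fun t => ?_)).trans (by simp)
          have h := ofReal_integral_eq_lintegral_ofReal ((hfi t).add (integrable_const B))
            (Eventually.of_forall fun ω => hfB t ω)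
          refine h.symm.trans_le ?_
          exact ENNReal.ofReal_le_ofReal (hint t)
  have hpi : Integrable (fun ω => G.payoff S T i ω + B) coinTosses :=
    (lintegral_ofReal_ne_top_iff_integrable (hm.add_const B).aestronglyMeasurable hnn).1
      (hfatou.trans_lt ENNReal.ofReal_lt_top).ne
  have hpi' : Integrable (G.payoff S T i) coinTosses := by
    simpa [Pi.sub_def] using hpi.sub (integrable_const B)
  rw [expectedPayoff, extendedExpectation_of_integrable hpi', EReal.coe_le_coe_iff]
  rw [← ofReal_integral_eq_lintegral_ofReal hpi hnn] at hfatou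
  have h2 : 0 ≤ u i + B := (integral_nonneg (hfB 0)).trans (hint 0)
  have h3 := (ENNReal.ofReal_le_ofReal_iff h2).1 hfatou
  rw [integral_add hpi' (integrable_const B)] at h3
  simpa using h3

/-- If the potential is a submartingale and Player II is forced a bounded number of times,
the potential bounds the expected payoff from below. -/
theorem le_expectedPayoff {u : ℕ → ℝ} (hε : 0 < G.ε) (h0 : u 0 = G.F₀) (h1 : u (G.n + 1) = G.F₁)
    (hi : i ≤ G.n) (he : G.EndsAlmostSurely S T i)
    (hF : ∀ h : History, 1 ≤ h.current → h.current ≤ G.n → G.potential u h ≤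
      (G.potential u (turn S T true h) + G.potential u (turn S T false h)) / 2)
    {K : ℕ} (hK : ∀ ω t, (G.historyAt S T i ω t).numForced ≤ K) :
    (u i : EReal) ≤ G.expectedPayoff S T i := by
  have hlim := tendsto_potential h0 h1 he
  set f : ℕ → (ℕ → Bool) → ℝ := fun t ω => G.potential u (G.historyAt S T i ω t) with hf
  set C : ℝ := ∑ x ∈ Finset.range (G.n + 2), |u x| + K * G.ε with hC
  have hfi : ∀ t, Integrable (f t) coinTosses := fun t => G.integrable_historyAt S T i _ t
  have hfC : ∀ t ω, ‖f t ω‖ ≤ C := by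
    intro t ω
    have hx := G.historyAt_current_le S T hi ω t
    have h2 := Finset.single_le_sum (f := fun x => |u x|) (fun _ _ => abs_nonneg _)
      (Finset.mem_range.2 (Nat.lt_succ_of_le hx))
    refine (abs_add_le _ _).trans (add_le_add h2 ?_)
    rw [abs_of_nonneg (by positivity)]
    exact mul_le_mul_of_nonneg_right (Nat.cast_le.2 (hK ω t)) hε.le
  have hpi : Integrable (G.payoff S T i) coinTosses := by
    refine Integrable.of_bound (aemeasurable_of_tendsto_metrizable_ae atTop
      (fun t => (hfi t).aemeasurable) hlim).aestronglyMeasurable C ?_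
    filter_upwards [hlim] with ω hω
    exact le_of_tendsto' hω.norm fun t => hfC t ω
  rw [expectedPayoff, extendedExpectation_of_integrable hpi, EReal.coe_le_coe_iff]
  refine ge_of_tendsto' (tendsto_integral_of_dominated_convergence (fun _ => C)
    (fun t => (hfi t).aestronglyMeasurable) (integrable_const C)
    (fun t => Eventually.of_forall (hfC t)) hlim) fun t => ?_
  have := G.le_integral_historyAt S T hi hF t
  simpa [History.numForced, hf, potential] using this

lemma potential_mean_of_force (u : ℕ → ℝ) {h : History} (hS : S h = .force) :
    (G.potential u (turn S T true h) + G.potential u (turn S T false h)) / 2 =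
      u ((T h).step h.current) + G.ε + h.numForced * G.ε := by
  simp [potential, turn_of_force hS]
  ring

lemma potential_mean_of_play (u : ℕ → ℝ) {h : History} {d : Direction} (hS : S h = .play d) :
    (G.potential u (turn S T true h) + G.potential u (turn S T false h)) / 2 =
      (u (d.step h.current) + u ((T h).step h.current)) / 2 + h.numForced * G.ε := by
  simp [potential, turn_true_of_play hS, turn_false_of_play hS]
  ring

/-! ### Strategies of Player II -/

/-- Player II makes the game end by always moving to the nearest end on his or her side of a
dividing edge. -/
theorem endsAlmostSurely_of_divide (hi : i ≤ G.n) (S : StrategyI) {g : ℕ → Direction} {k : ℕ}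
    (hl : ∀ x, 1 ≤ x → x ≤ G.n → x ≤ k → g x = .left)
    (hr : ∀ x, 1 ≤ x → x ≤ G.n → k < x → g x = .right) :
    G.EndsAlmostSurely S (.ofNode g) i := by
  -- The distance to the end on the same side of the dividing edge. It drops whenever Player II
  -- moves, hence at least when the toss is `false`, whatever Player I does.
  let r : ℕ → ℕ := fun x => if x ≤ k then x else G.n + 1 - x
  refine G.endsAlmostSurely_of_rank S _ hi (fun h => r h.current) (k + G.n + 1) (fun h => ?_)
    fun h h1 h2 => ⟨false, ?_⟩
  · simp only [r]; split_ifs <;> omega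
  · have hc : (turn S (.ofNode g) false h).current = (g h.current).step h.current := by
      rcases hS : S h with d | _
      · simp [turn_false_of_play hS, StrategyII.ofNode]
      · simp [turn_of_force hS, StrategyII.ofNode]
    simp only [hc, r]
    by_cases hk : h.current ≤ k
    · rw [hl _ h1 h2 hk, Direction.step_left, if_pos hk, if_pos (by omega)]
      omega
    · rw [hr _ h1 h2 (by omega), Direction.step_right, if_neg hk, if_neg (by omega)]
      omega

/-- The two inequalities cover the two actions available to Player I, so the potential is a
supermartingale against every `S`, even one that depends on the history. -/
theorem expectedPayoff_le_of_superharmonic {u : ℕ → ℝ} (hε : 0 < G.ε) (h0 : u 0 = G.F₀)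
    (h1 : u (G.n + 1) = G.F₁) (hi : i ≤ G.n) {g : ℕ → Direction}
    (he : G.EndsAlmostSurely S (.ofNode g) i)
    (hforce : ∀ x, 1 ≤ x → x ≤ G.n → u ((g x).step x) + G.ε ≤ u x)
    (hplay : ∀ x, 1 ≤ x → x ≤ G.n → ∀ d : Direction, (u (d.step x) + u ((g x).step x)) / 2 ≤ u x) :
    G.expectedPayoff S (.ofNode g) i ≤ (u i : EReal) := by
  refine expectedPayoff_le hε h0 h1 hi he fun h hx hx' => ?_
  rcases hS : S h with d | _
  · rw [potential_mean_of_play u hS]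
    exact add_le_add_left (hplay _ hx hx' d) _
  · rw [potential_mean_of_force u hS]
    exact add_le_add_left (hforce _ hx hx') _

lemma valueII_le {c : EReal} (T : StrategyII) (he : ∀ S, G.EndsAlmostSurely S T i)
    (hle : ∀ S, G.expectedPayoff S T i ≤ c) : G.valueII i ≤ c := by
  refine iInf_le_of_le T (iSup_le fun S => ?_)
  rw [payoffII, if_pos (he S)]
  exact hle S

lemma le_valueI {c : EReal} (S : StrategyI) (he : ∀ T, G.EndsAlmostSurely S T i)
    (hle : ∀ T, c ≤ G.expectedPayoff S T i) : c ≤ G.valueI i := by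
  refine le_iSup_of_le S (le_iInf fun T => ?_)
  rw [payoffI, if_pos (he T)]
  exact hle T

/-- Besides the minimax inequality, this uses that the two payoffs differ only when the game fails
to end, where they are `⊥` and `⊤`. -/
lemma valueI_le_valueII (i : ℕ) : G.valueI i ≤ G.valueII i := by
  refine (iSup_iInf_le_iInf_iSup _).trans (iInf_mono fun T => iSup_mono fun S => ?_)
  rw [payoffI, payoffII]
  split_ifs
  · exact le_rfl
  · exact bot_le

lemma HasValue.of_le {u : ℕ → ℝ} (hI : ∀ i, 1 ≤ i → i ≤ G.n → (u i : EReal) ≤ G.valueI i)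
    (hII : ∀ i, 1 ≤ i → i ≤ G.n → G.valueII i ≤ (u i : EReal)) : G.HasValue u := fun i h1 h2 =>
  ⟨((valueI_le_valueII i).trans (hII i h1 h2)).antisymm (hI i h1 h2),
    (hII i h1 h2).antisymm ((hI i h1 h2).trans (valueI_le_valueII i))⟩

/-! ### Strategies of Player I -/

/-- Player I forces Player II to choose for the first `K` turns, and then plays classical random
Tug-of-War, moving towards `x_{n+1}`. -/
def forceThenPull (K : ℕ) : StrategyI := fun h =>
  if h.numForced < K then .force else .play .right

theorem endsAlmostSurely_forceThenPull (hi : i ≤ G.n) (K : ℕ) (T : StrategyII) :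
    G.EndsAlmostSurely (forceThenPull K) T i := by
  -- A lexicographic rank: using up one forced turn gains `n + 2`, more than the distance to
  -- `x_{n+1}` can grow. Once forcing is over, a toss won by Player I shortens that distance.
  refine G.endsAlmostSurely_of_rank _ T hi (fun h => (K - h.numForced) * (G.n + 2) +
    (G.n + 1 - h.current)) (K * (G.n + 2) + (G.n + 1)) (fun h => ?_) fun h h1 h2 => ⟨true, ?_⟩
  · exact add_le_add (Nat.mul_le_mul_right _ (Nat.sub_le _ _)) (Nat.sub_le _ _)
  · by_cases hk : h.numForced < K
    · have hS : forceThenPull K h = .force := if_pos hk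
      simp only [turn_of_force hS, History.numForced_extend_forcedII]
      obtain ⟨m, hm⟩ : ∃ m, K - h.numForced = m + 1 := ⟨K - h.numForced - 1, by omega⟩
      rw [hm, show K - (h.numForced + 1) = m by omega, add_mul]
      omega
    · have hS : forceThenPull K h = .play .right := if_neg hk
      simp only [turn_true_of_play hS, History.numForced_extend_wonByI, History.current_extend,
        TurnRecord.dir_wonByI, Direction.step_right]
      omega

/-- If `u` changes by at most `ε` along edges, Player I can secure `u`. -/
theorem le_valueI_of_lipschitz {u : ℕ → ℝ} (hε : 0 < G.ε) (hF : G.F₀ ≤ G.F₁) (h0 : u 0 = G.F₀)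
    (h1 : u (G.n + 1) = G.F₁) (hi : i ≤ G.n)
    (hu : ∀ x, 1 ≤ x → x ≤ G.n → ∀ d : Direction, u x ≤ u (d.step x) + G.ε) :
    (u i : EReal) ≤ G.valueI i := by
  obtain ⟨K, hK⟩ := exists_nat_gt ((u i - G.F₀) / G.ε)
  rw [div_lt_iff₀ hε] at hK
  refine le_valueI (forceThenPull K) (fun T => endsAlmostSurely_forceThenPull hi K T) fun T => ?_
  rw [← extendedExpectation_const coinTosses (u i)]
  refine extendedExpectation_mono ?_
  filter_upwards [endsAlmostSurely_forceThenPull hi K T] with ω hω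
  -- Before the `K`-th forced turn every turn is forced, so the potential has never dropped below `u
  -- i`; afterwards the count alone is enough.
  have hinv := G.historyAt_induction (forceThenPull K) T i
    (p := fun h => h.current ≤ G.n + 1 ∧ (K ≤ h.numForced ∨ u i ≤ G.potential u h))
    ⟨by simp only; omega, Or.inr (by simp [potential, History.numForced])⟩
    (fun h b ht hp => ?_) ω (sInf (G.terminalTimes (forceThenPull K) T i ω))
  · rcases hinv.2 with h | h
    · have hge : G.F₀ ≤ G.terminalPayoff (G.finalHistory (forceThenPull K) T i ω).current := by
        rw [terminalPayoff]
        split_ifs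
        exacts [le_rfl, hF]
      have : (K : ℝ) * G.ε ≤ (G.finalHistory (forceThenPull K) T i ω).numForced * G.ε :=
        mul_le_mul_of_nonneg_right (Nat.cast_le.2 h) hε.le
      rw [payoff]
      linarith
    · rwa [← potential_finalHistory h0 h1 hω]
  · obtain ⟨hx, hp⟩ := hp
    rw [mem_terminal] at ht
    refine ⟨turn_current_le _ _ (by omega), ?_⟩
    by_cases hk : h.numForced < K
    · have hS : forceThenPull K h = .force := if_pos hk
      have h2 := hp.resolve_left (by omega)
      have h3 := hu h.current (by omega) (by omega) (T h)
      refine Or.inr (h2.trans ?_)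
      simp only [potential, turn_of_force hS, History.numForced_extend_forcedII,
        History.current_extend, TurnRecord.dir_forcedII]
      push_cast
      linarith
    · have hS : forceThenPull K h = .play .right := if_neg hk
      left
      cases b
      · rw [turn_false_of_play hS, History.numForced_extend_wonByII]; omega
      · rw [turn_true_of_play hS, History.numForced_extend_wonByI]; omega

/-- If `u` is nondecreasing and subharmonic, Player I secures `u` by pulling towards `x_{n+1}`. -/
theorem le_valueI_of_subharmonic {u : ℕ → ℝ} (hε : 0 < G.ε) (h0 : u 0 = G.F₀)
    (h1 : u (G.n + 1) = G.F₁) (hi : i ≤ G.n)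
    (hu : ∀ x, 1 ≤ x → x ≤ G.n → ∀ d : Direction, u x ≤ (u (x + 1) + u (d.step x)) / 2) :
    (u i : EReal) ≤ G.valueI i := by
  have hS : ∀ h, forceThenPull 0 h = .play .right := fun h => if_neg (Nat.not_lt_zero _)
  refine le_valueI (forceThenPull 0) (fun T => endsAlmostSurely_forceThenPull hi 0 T) fun T => ?_
  refine le_expectedPayoff hε h0 h1 hi (endsAlmostSurely_forceThenPull hi 0 T)
    (fun h hx hx' => ?_) (K := 0) fun ω t => ?_
  · rw [potential_mean_of_play u (hS h)]
    exact add_le_add_left (hu _ hx hx' _) _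
  · refine G.historyAt_induction (forceThenPull 0) T i (p := fun h => h.numForced ≤ 0)
      (by simp [History.numForced]) (fun h b _ hh => ?_) ω t
    cases b
    · rwa [turn_false_of_play (hS h), History.numForced_extend_wonByII]
    · rwa [turn_true_of_play (hS h), History.numForced_extend_wonByI]

/-! ### Pairs of strategies realizing the value -/

/-- Player I forces Player II at `x_i` with `i ≤ j` or `k < i`, and pulls towards `x_{n+1}` in
between; Player II moves towards `x_0` at `x_i` with `i ≤ k`, and towards `x_{n+1}` otherwise. -/
theorem realizes_of_harmonic {u : ℕ → ℝ} (hε : 0 < G.ε) (h0 : u 0 = G.F₀)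
    (h1 : u (G.n + 1) = G.F₁) {f : ℕ → ActionI} {g : ℕ → Direction} {j k : ℕ} (hjk : j ≤ k)
    (hl : ∀ x, 1 ≤ x → x ≤ G.n → x ≤ k → g x = .left)
    (hr : ∀ x, 1 ≤ x → x ≤ G.n → k < x → g x = .right)
    (hfl : ∀ x, 1 ≤ x → x ≤ G.n → x ≤ j → f x = .force ∧ u x = u (x - 1) + G.ε)
    (hfm : ∀ x, 1 ≤ x → x ≤ G.n → j < x → x ≤ k →
      f x = .play .right ∧ u x = (u (x + 1) + u (x - 1)) / 2)
    (hfr : ∀ x, 1 ≤ x → x ≤ G.n → k < x → f x = .force ∧ u x = u (x + 1) + G.ε) :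
    G.Realizes (.ofNode f) (.ofNode g) u := by
  intro i _ hi
  have he := endsAlmostSurely_of_divide hi (.ofNode f) hl hr
  have hmean : ∀ h : History, 1 ≤ h.current → h.current ≤ G.n →
      (G.potential u (turn (.ofNode f) (.ofNode g) true h) +
        G.potential u (turn (.ofNode f) (.ofNode g) false h)) / 2 = G.potential u h := by
    intro h hx hx'
    rcases le_or_gt h.current j with hj | hj
    · obtain ⟨hf, hu⟩ := hfl _ hx hx' hj
      rw [potential_mean_of_force u hf, StrategyII.ofNode, hl _ hx hx' (hj.trans hjk),
        Direction.step_left, potential, hu]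
    rcases le_or_gt h.current k with hk | hk
    · obtain ⟨hf, hu⟩ := hfm _ hx hx' hj hk
      rw [potential_mean_of_play u hf, StrategyII.ofNode, hl _ hx hx' hk, Direction.step_left,
        Direction.step_right, potential, hu]
    · obtain ⟨hf, hu⟩ := hfr _ hx hx' hk
      rw [potential_mean_of_force u hf, StrategyII.ofNode, hr _ hx hx' hk, Direction.step_right,
        potential, hu]
  refine ⟨he, le_antisymm (expectedPayoff_le hε h0 h1 hi he fun h a b => (hmean h a b).le)
    (le_expectedPayoff hε h0 h1 hi he (fun h a b => (hmean h a b).ge) (K := G.n)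
      fun ω t => ?_)⟩
  -- Bounds the number of forced turns still to come. The outer zones are never left except by
  -- ending the game, so their bound is the distance to the end. In the middle zone nothing has been
  -- forced yet, and `n` covers either exit.
  let φ : ℕ → ℕ := fun x => if x ≤ j then x else if x ≤ k then G.n else G.n + 1 - x
  have := G.historyAt_induction (.ofNode f) (.ofNode g) i
    (p := fun h => h.current ≤ G.n + 1 ∧ h.numForced + φ h.current ≤ G.n)
    ⟨by simp only; omega, by
      simp only [φ, History.numForced, List.countP_nil]; split_ifs <;> omega⟩
    (fun h b ht hp => ?_) ω t
  · omega
  · obtain ⟨hx, hp⟩ := hp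
    rw [mem_terminal] at ht
    refine ⟨turn_current_le _ _ (by omega), ?_⟩
    have hx : 1 ≤ h.current := by omega
    have hx' : h.current ≤ G.n := by omega
    rcases le_or_gt h.current j with hj | hj
    · rw [turn_of_force (hfl _ hx hx' hj).1, History.numForced_extend_forcedII,
        History.current_extend, TurnRecord.dir_forcedII, StrategyII.ofNode,
        hl _ hx hx' (hj.trans hjk), Direction.step_left]
      simp only [φ] at hp ⊢
      rw [if_pos hj] at hp
      rw [if_pos (by omega)]
      omega
    rcases le_or_gt h.current k with hk | hk
    · have hf := (hfm _ hx hx' hj hk).1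
      have hφ : ∀ y, h.current ≤ y + 1 → φ y ≤ G.n := fun y _ => by
        simp only [φ]; split_ifs <;> omega
      have hφ' : φ h.current = G.n := by rw [show φ h.current = _ from if_neg (by omega), if_pos hk]
      cases b
      · rw [turn_false_of_play hf, History.numForced_extend_wonByII, History.current_extend,
          TurnRecord.dir_wonByII, StrategyII.ofNode, hl _ hx hx' hk, Direction.step_left]
        have := hφ (h.current - 1) (by omega)
        omega
      · rw [turn_true_of_play hf, History.numForced_extend_wonByI, History.current_extend,
          TurnRecord.dir_wonByI, Direction.step_right]
        have := hφ (h.current + 1) (by omega)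
        omega
    · rw [turn_of_force (hfr _ hx hx' hk).1, History.numForced_extend_forcedII,
        History.current_extend, TurnRecord.dir_forcedII, StrategyII.ofNode,
        hr _ hx hx' hk, Direction.step_right]
      simp only [φ] at hp ⊢
      split_ifs at hp ⊢ <;> omega

lemma HasValue.congr {u v : ℕ → ℝ} (h : G.HasValue u) (huv : ∀ i, 1 ≤ i → i ≤ G.n → u i = v i) :
    G.HasValue v := fun i h1 h2 => huv i h1 h2 ▸ h i h1 h2

lemma Realizes.congr {u v : ℕ → ℝ} (h : G.Realizes S T u)
    (huv : ∀ i, 1 ≤ i → i ≤ G.n → u i = v i) : G.Realizes S T v :=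
  fun i h1 h2 => huv i h1 h2 ▸ h i h1 h2

/-! ### The linear profile -/

/-- The linear interpolation of the terminal payoffs. -/
def linearProfile (G : SegmentGame) (i : ℕ) : ℝ :=
  ((G.n : ℝ) + 1 - i) / (G.n + 1) * G.F₀ + (i : ℝ) / (G.n + 1) * G.F₁

lemma linearProfile_eq (G : SegmentGame) (i : ℕ) :
    G.linearProfile i = G.F₀ + i * ((G.F₁ - G.F₀) / (G.n + 1)) := by
  have : (G.n : ℝ) + 1 ≠ 0 := by positivity
  rw [linearProfile]
  field_simp
  ring

lemma linearProfile_zero (G : SegmentGame) : G.linearProfile 0 = G.F₀ := by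
  simp [linearProfile_eq]

lemma linearProfile_last (G : SegmentGame) : G.linearProfile (G.n + 1) = G.F₁ := by
  have : (G.n : ℝ) + 1 ≠ 0 := by positivity
  rw [linearProfile_eq]
  push_cast
  field_simp
  ring

lemma linearProfile_sub_one {x : ℕ} (hx : 1 ≤ x) :
    G.linearProfile (x - 1) = G.linearProfile x - (G.F₁ - G.F₀) / (G.n + 1) := by
  rw [linearProfile_eq, linearProfile_eq, Nat.cast_sub hx]
  push_cast
  ring

lemma linearProfile_add_one (x : ℕ) :
    G.linearProfile (x + 1) = G.linearProfile x + (G.F₁ - G.F₀) / (G.n + 1) := by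
  rw [linearProfile_eq, linearProfile_eq]
  push_cast
  ring

/-- With slope at least `ε`, the payment for a forced step to the left does not exceed the resulting
loss in `u`. -/
theorem hasValue_linearProfile (hε : 0 < G.ε)
    (hs : G.ε ≤ (G.F₁ - G.F₀) / (G.n + 1)) : G.HasValue G.linearProfile := by
  have h0 := G.linearProfile_zero
  have h1 := G.linearProfile_last
  refine HasValue.of_le (fun i _ hi => le_valueI_of_subharmonic hε h0 h1 hi fun x hx _ d => ?_)
    fun i _ hi => ?_
  · rw [linearProfile_add_one]
    cases d
    · rw [Direction.step_left, linearProfile_sub_one hx]; linarith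
    · rw [Direction.step_right, linearProfile_add_one]; linarith
  · have he : ∀ S, G.EndsAlmostSurely S (.ofNode fun _ => .left) i := fun S =>
      endsAlmostSurely_of_divide hi S (k := G.n) (fun _ _ _ _ => rfl) fun x _ _ _ => by omega
    refine valueII_le _ he fun S => expectedPayoff_le_of_superharmonic hε h0 h1 hi (he S)
      (fun x hx _ => ?_) fun x hx _ d => ?_
    · rw [Direction.step_left, linearProfile_sub_one hx]; linarith
    · rw [Direction.step_left, linearProfile_sub_one hx]
      cases d
      · rw [Direction.step_left, linearProfile_sub_one hx]; linarith
      · rw [Direction.step_right, linearProfile_add_one]; linarith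

theorem realizes_linearProfile (hε : 0 < G.ε) :
    G.Realizes (.ofNode fun _ => .play .right) (.ofNode fun _ => .left) G.linearProfile := by
  refine realizes_of_harmonic hε G.linearProfile_zero G.linearProfile_last (j := 0) (k := G.n)
    (Nat.zero_le _) (fun _ _ _ _ => rfl) (fun x _ _ _ => by omega) (fun x _ _ _ => by omega)
    (fun x hx _ _ _ => ⟨rfl, ?_⟩) (fun x _ _ _ => by omega)
  rw [linearProfile_sub_one hx, linearProfile_add_one]
  ring

/-! ### The profile with a dividing edge -/

/-- The payoff if Player II is forced to walk to `x_0` from `x_i` with `i ≤ k`, and to `x_{n+1}`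
from `x_i` with `i > k`. -/
def dividedProfile (G : SegmentGame) (k i : ℕ) : ℝ :=
  if i ≤ k then G.F₀ + i * G.ε else G.F₁ + ((G.n : ℝ) + 1 - i) * G.ε

lemma dividedProfile_zero (G : SegmentGame) (k : ℕ) : G.dividedProfile k 0 = G.F₀ := by
  simp [dividedProfile]

lemma dividedProfile_last {k : ℕ} (hk : k ≤ G.n) : G.dividedProfile k (G.n + 1) = G.F₁ := by
  rw [dividedProfile, if_neg (by omega)]
  simp

lemma dividedProfile_sub_one_of_le {k x : ℕ} (hx : 1 ≤ x) (hk : x ≤ k) :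
    G.dividedProfile k (x - 1) = G.dividedProfile k x - G.ε := by
  rw [dividedProfile, dividedProfile, if_pos hk, if_pos (by omega), Nat.cast_sub hx]
  push_cast
  ring

lemma dividedProfile_add_one_of_lt {k x : ℕ} (hk : x < k) :
    G.dividedProfile k (x + 1) = G.dividedProfile k x + G.ε := by
  rw [dividedProfile, dividedProfile, if_pos hk.le, if_pos (by omega)]
  push_cast
  ring

lemma dividedProfile_add_one_of_gt {k x : ℕ} (hk : k < x) :
    G.dividedProfile k (x + 1) = G.dividedProfile k x - G.ε := by
  rw [dividedProfile, dividedProfile, if_neg (by omega), if_neg (by omega)]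
  push_cast
  ring

/-- The dividing edge is the only one where the increment is not `±ε`; the conditions on `Q` are
conditions on this jump. -/
lemma dividedProfile_divide (G : SegmentGame) (k : ℕ) :
    G.dividedProfile k (k + 1) =
      G.dividedProfile k k + (G.F₁ - G.F₀ - (2 * (k : ℝ) - G.n) * G.ε) := by
  rw [dividedProfile, dividedProfile, if_pos le_rfl, if_neg (by omega)]
  push_cast
  ring

lemma dividedProfile_add_one_mem {k : ℕ} (hε : 0 < G.ε)
    (h1 : (2 * (k : ℝ) - G.n - 1) * G.ε ≤ G.F₁ - G.F₀)
    (h2 : G.F₁ - G.F₀ ≤ (2 * (k : ℝ) - G.n + 1) * G.ε) (x : ℕ) :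
    G.dividedProfile k x - G.ε ≤ G.dividedProfile k (x + 1) ∧
      G.dividedProfile k (x + 1) ≤ G.dividedProfile k x + G.ε := by
  rcases lt_trichotomy x k with h | rfl | h
  · rw [dividedProfile_add_one_of_lt h]; constructor <;> linarith
  · rw [dividedProfile_divide]; constructor <;> linarith
  · rw [dividedProfile_add_one_of_gt h]; constructor <;> linarith

/-- Player II always has a step that lowers `u` by exactly `ε`, which cancels the payment for
forcing and offsets any rise, at most `ε`, that Player I obtains by winning a toss. -/
theorem hasValue_dividedProfile {k : ℕ} (hε : 0 < G.ε) (hF : G.F₀ ≤ G.F₁) (hk : k ≤ G.n)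
    (h1 : (2 * (k : ℝ) - G.n - 1) * G.ε ≤ G.F₁ - G.F₀)
    (h2 : G.F₁ - G.F₀ ≤ (2 * (k : ℝ) - G.n + 1) * G.ε) : G.HasValue (G.dividedProfile k) := by
  have e0 := G.dividedProfile_zero k
  have e1 := dividedProfile_last hk
  have hL : ∀ x, 1 ≤ x → ∀ d : Direction,
      G.dividedProfile k x - G.ε ≤ G.dividedProfile k (d.step x) ∧
      G.dividedProfile k (d.step x) ≤ G.dividedProfile k x + G.ε := by
    intro x hx d
    cases d
    · have h := dividedProfile_add_one_mem hε h1 h2 (x - 1)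
      rw [Nat.sub_add_cancel hx] at h
      rw [Direction.step_left]
      constructor <;> linarith [h.1, h.2]
    · exact dividedProfile_add_one_mem hε h1 h2 x
  refine HasValue.of_le (fun i _ hi => le_valueI_of_lipschitz hε hF e0 e1 hi fun x hx _ d => ?_)
    fun i _ hi => ?_
  · linarith [(hL x hx d).1]
  · let g : ℕ → Direction := fun x => if x ≤ k then .left else .right
    have hg : ∀ x, 1 ≤ x → G.dividedProfile k ((g x).step x) = G.dividedProfile k x - G.ε := by
      intro x hx
      simp only [g]
      split_ifs with h
      · exact dividedProfile_sub_one_of_le hx h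
      · exact dividedProfile_add_one_of_gt (by omega)
    have he : ∀ S, G.EndsAlmostSurely S (.ofNode g) i := fun S =>
      endsAlmostSurely_of_divide hi S (k := k) (fun _ _ _ h => if_pos h)
        fun x _ _ h => if_neg (by omega)
    refine valueII_le _ he fun S => expectedPayoff_le_of_superharmonic hε e0 e1 hi (he S)
      (fun x hx _ => ?_) fun x hx _ d => ?_
    · rw [hg x hx]; linarith
    · rw [hg x hx]; linarith [(hL x hx d).2]

theorem realizes_dividedProfile {k j : ℕ} (hε : 0 < G.ε) (hk : k ≤ G.n) (hj : j ≤ k)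
    (hQ : j < k → G.F₁ - G.F₀ = (2 * (k : ℝ) - G.n + 1) * G.ε)
    {f : ℕ → ActionI} {g : ℕ → Direction}
    (hl : ∀ x, 1 ≤ x → x ≤ G.n → x ≤ k → g x = .left)
    (hr : ∀ x, 1 ≤ x → x ≤ G.n → k < x → g x = .right)
    (hfl : ∀ x, 1 ≤ x → x ≤ G.n → x ≤ j → f x = .force)
    (hfm : ∀ x, 1 ≤ x → x ≤ G.n → j < x → x ≤ k → f x = .play .right)
    (hfr : ∀ x, 1 ≤ x → x ≤ G.n → k < x → f x = .force) :
    G.Realizes (.ofNode f) (.ofNode g) (G.dividedProfile k) := by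
  refine realizes_of_harmonic hε (G.dividedProfile_zero k) (dividedProfile_last hk) hj hl hr
    (fun x hx hx' h => ⟨hfl x hx hx' h, ?_⟩) (fun x hx hx' h h' => ⟨hfm x hx hx' h h', ?_⟩)
    (fun x hx hx' h => ⟨hfr x hx hx' h, ?_⟩)
  · rw [dividedProfile_sub_one_of_le hx (h.trans hj)]; ring
  · rw [dividedProfile_sub_one_of_le hx h']
    -- Only at `x = k` does harmonicity involve the jump, which `hQ` makes equal to `ε`.
    rcases h'.lt_or_eq with h' | rfl
    · rw [dividedProfile_add_one_of_lt h']; ring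
    · rw [dividedProfile_divide, hQ h]; ring
  · rw [dividedProfile_add_one_of_gt h]; ring

lemma exists_divide (hn : 2 ≤ G.n) (hQ : 0 ≤ G.Q) (hQ' : G.Q ≤ (G.n : ℝ) - 1) :
    ∃ k : ℕ, 1 ≤ k ∧ k + 1 ≤ G.n ∧
      2 * (k : ℝ) - G.n - 1 < G.Q ∧ G.Q ≤ 2 * (k : ℝ) - G.n + 1 := by
  have hn' : (2 : ℝ) ≤ G.n := by exact_mod_cast hn
  have hpos : 0 < (G.Q + G.n - 1) / 2 := by linarith
  -- The least `k` with `Q ≤ 2k - n + 1`; it is positive because `Q ≥ 0` and `n ≥ 2`.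
  refine ⟨⌈(G.Q + G.n - 1) / 2⌉₊, Nat.ceil_pos.2 hpos, ?_, ?_, ?_⟩
  · have : ⌈(G.Q + G.n - 1) / 2⌉₊ ≤ G.n - 1 := Nat.ceil_le.2 (by
      rw [Nat.cast_sub (by omega)]; push_cast; linarith)
    omega
  · linarith [Nat.ceil_lt_add_one hpos.le]
  · linarith [Nat.le_ceil ((G.Q + G.n - 1) / 2)]

end SegmentGame

end

/-! ### The three regimes of `Q` -/

theorem theorem3p1 (G : SegmentGame) (hn : 2 ≤ G.n) (hε : 0 < G.ε) (hF : G.F₀ ≤ G.F₁) :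
    -- the cases are exhaustive
    (0 ≤ G.Q ∧
      ((G.n : ℝ) + 1 < G.Q ∨
        ((G.n : ℝ) - 1 < G.Q ∧ G.Q ≤ (G.n : ℝ) + 1) ∨
        ∃ k : ℕ, 1 ≤ k ∧ k + 1 ≤ G.n ∧
          2 * (k : ℝ) - G.n - 1 < G.Q ∧ G.Q ≤ 2 * (k : ℝ) - G.n + 1)) ∧
    -- (a)
    ((G.n : ℝ) + 1 < G.Q →
      G.HasValue (fun i => ((G.n : ℝ) + 1 - i) / (G.n + 1) * G.F₀ + (i : ℝ) / (G.n + 1) * G.F₁) ∧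
      G.Realizes
        (StrategyI.ofNode fun _ => ActionI.play Direction.right)
        (StrategyII.ofNode fun _ => Direction.left)
        (fun i => ((G.n : ℝ) + 1 - i) / (G.n + 1) * G.F₀ + (i : ℝ) / (G.n + 1) * G.F₁)) ∧
    -- (b)
    ((G.n : ℝ) - 1 < G.Q → G.Q ≤ (G.n : ℝ) + 1 →
      G.HasValue (fun i => G.F₀ + i * G.ε) ∧
      G.Realizes
        (StrategyI.ofNode fun _ => ActionI.force)
        (StrategyII.ofNode fun _ => Direction.left)
        (fun i => G.F₀ + i * G.ε) ∧
      (G.Q = (G.n : ℝ) + 1 → ∀ j : ℕ, j ≤ G.n →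
        G.Realizes
          (StrategyI.ofNode fun i =>
            if i ≤ j then ActionI.force else ActionI.play Direction.right)
          (StrategyII.ofNode fun _ => Direction.left)
          (fun i => G.F₀ + i * G.ε))) ∧
    -- (c)
    (∀ k : ℕ, 1 ≤ k → k + 1 ≤ G.n →
      2 * (k : ℝ) - G.n - 1 < G.Q → G.Q ≤ 2 * (k : ℝ) - G.n + 1 →
      G.HasValue (fun i =>
        if i ≤ k then G.F₀ + i * G.ε else G.F₁ + ((G.n : ℝ) + 1 - i) * G.ε) ∧
      G.Realizes
        (StrategyI.ofNode fun _ => ActionI.force)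
        (StrategyII.ofNode fun i => if i ≤ k then Direction.left else Direction.right)
        (fun i => if i ≤ k then G.F₀ + i * G.ε else G.F₁ + ((G.n : ℝ) + 1 - i) * G.ε) ∧
      (G.Q = 2 * (k : ℝ) - G.n + 1 → ∀ j : ℕ, j ≤ k →
        G.Realizes
          (StrategyI.ofNode fun i =>
            if i ≤ j then ActionI.force
            else if i ≤ k then ActionI.play Direction.right
            else ActionI.force)
          (StrategyII.ofNode fun i => if i ≤ k then Direction.left else Direction.right)
          (fun i => if i ≤ k then G.F₀ + i * G.ε else G.F₁ + ((G.n : ℝ) + 1 - i) * G.ε))) := by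
  have hQ0 : 0 ≤ G.Q := div_nonneg (sub_nonneg.2 hF) hε.le
  have hQε : G.F₁ - G.F₀ = G.Q * G.ε := (div_mul_cancel₀ _ hε.ne').symm
  -- Case (b) is the divided profile with `k = n`. The formulas may disagree at `n + 1`, but the
  -- value only concerns running nodes.
  have hwedge : ∀ i, 1 ≤ i → i ≤ G.n → G.dividedProfile G.n i = G.F₀ + i * G.ε :=
    fun i _ hi => if_pos hi
  refine ⟨⟨hQ0, ?_⟩, fun hQ => ?_, fun hQ hQ' => ?_, fun k hk hkn hQ hQ' => ?_⟩
  · rcases lt_or_ge ((G.n : ℝ) + 1) G.Q with h | h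
    · exact Or.inl h
    rcases lt_or_ge ((G.n : ℝ) - 1) G.Q with h' | h'
    · exact Or.inr (Or.inl ⟨h', h⟩)
    · exact Or.inr (Or.inr (SegmentGame.exists_divide hn hQ0 h'))
  · refine ⟨SegmentGame.hasValue_linearProfile hε ?_, SegmentGame.realizes_linearProfile hε⟩
    rw [le_div_iff₀ (by positivity), hQε, mul_comm]
    exact mul_le_mul_of_nonneg_right hQ.le hε.le
  · refine ⟨(SegmentGame.hasValue_dividedProfile hε hF le_rfl ?_ ?_).congr hwedge,
      (SegmentGame.realizes_dividedProfile hε le_rfl (le_refl G.n) (fun h => absurd h (lt_irrefl _))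
        (fun _ _ _ _ => rfl) (fun x _ _ _ => by omega) (fun _ _ _ _ => rfl)
        (fun x _ _ _ => by omega) (fun x _ _ _ => by omega)).congr hwedge,
      fun hQe j hj => (SegmentGame.realizes_dividedProfile hε le_rfl hj (fun _ => ?_)
        (fun _ _ _ _ => rfl) (fun x _ _ _ => by omega) (fun _ _ _ h => if_pos h)
        (fun x _ _ h _ => if_neg (by omega)) (fun x _ _ _ => by omega)).congr hwedge⟩
    · rw [hQε]
      exact mul_le_mul_of_nonneg_right (by linarith) hε.le
    · rw [hQε]
      exact mul_le_mul_of_nonneg_right (by linarith) hε.le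
    · rw [hQε, hQe]
      ring
  · refine ⟨SegmentGame.hasValue_dividedProfile hε hF (by omega) ?_ ?_,
      SegmentGame.realizes_dividedProfile hε (by omega) (le_refl k)
        (fun h => absurd h (lt_irrefl _))
        (fun _ _ _ h => if_pos h) (fun x _ _ _ => if_neg (by omega)) (fun _ _ _ _ => rfl)
        (fun x _ _ _ => by omega) (fun _ _ _ _ => rfl),
      fun hQe j hj => SegmentGame.realizes_dividedProfile hε (by omega) hj (fun _ => ?_)
        (fun _ _ _ h => if_pos h) (fun x _ _ _ => if_neg (by omega)) (fun _ _ _ h => if_pos h)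
        (fun x _ _ h h' => by rw [if_neg (by omega), if_pos h'])
        (fun x _ _ _ => by rw [if_neg (by omega), if_neg (by omega)])⟩
    · rw [hQε]
      exact mul_le_mul_of_nonneg_right hQ.le hε.le
    · rw [hQε]
      exact mul_le_mul_of_nonneg_right hQ' hε.le
    · rw [hQε, hQe]
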